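/- Let $M$ be a smooth ($C^\infty$) manifold without boundary, equipped with a smooth Riemannian metric $\langle\cdot,\cdot\rangle$ with Levi-Civita connection $\nabla$, and let $f : M \to \mathbb{R}$ be smooth. Write $\Delta f = \operatorname{Tr}[v \mapsto \nabla_v \nabla f]$ for the Laplacian, and for $t \in \mathbb{R}$ write $Z_t = \{y \in M : f(y) = t\}$. For a smooth hypersurface $Z \subseteq M$ with unit normal field $N$ and a function $\rho$ on $M$ that is smooth near $x \in Z$, the mean curvature and the weighted mean curvature of $Z$ at $x$ with respect to $N$ are $$H(x) = -\operatorname{Tr}\left[ T_xZ \ni u \mapsto \nabla_u N \in T_xZ\right], \qquad H_\rho(x) = \rho(x) H(x) - \langle \nabla\rho(x), N(x)\rangle .$$ Take $\rho = |\nabla f|$ and $N = \nabla f/|\nabla f|$. (1) Let $x \in M$ be a regular point of $f$ (that is, $df_x \neq 0$) and let $t = f(x)$. Then, near $x$, the set $Z_t$ is a smooth embedded hypersurface, $N$ is smooth and is a unit normal to $Z_t$, the function $\rho$ is smooth, and the weighted mean curvature of $Z_t$ at $x$ with respect to $N$ is $$H_\rho(x) = -\Delta f(x).$$ In $\nabla_u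 N$ the field $N$ may be replaced by any vector field that is smooth near $x$ and agrees with $\nabla f/|\nabla f|$ on $Z_t$ near $x$. (2) Suppose that $\Delta f = -\lambda f$ on $M$ for some $\lambda \in \mathbb{R}$. If $t$ is a regular value of $f$ (all points of $Z_t$ are regular points), then $Z_t$ is a smooth hypersurface whose weighted mean curvature with respect to $N$ is constant, equal to $\lambda t$. In particular, if $0$ is a regular value of $f$, then the nodal set $Z_0$ is a smooth weighted minimal hypersurface, i.e. $H_\rho = 0$ on $Z_0$. -/

import Mathlib

open Bundle Set Filter VectorField
open scoped Manifold ContDiff Topology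

noncomputable section RiemannianGeometry

section Instances

variable {E : Type*} [NormedAddCommGroup E] [NormedSpace ℝ E] [FiniteDimensional ℝ E]
  {M : Type*} [TopologicalSpace M] [ChartedSpace E M]

/-- Tangent spaces are finite-dimensional. -/
instance tangentSpace_finiteDimensional (x : M) :
    FiniteDimensional ℝ (TangentSpace 𝓘(ℝ, E) x) :=
  inferInstanceAs (FiniteDimensional ℝ E)

/-- Tangent spaces of a Riemannian manifold are complete, being finite-dimensional. -/
instance tangentSpace_completeSpace [RiemannianBundle (fun x : M ↦ TangentSpace 𝓘(ℝ, E) x)]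
    (x : M) : CompleteSpace (TangentSpace 𝓘(ℝ, E) x) :=
  FiniteDimensional.complete ℝ _

end Instances

section LeviCivita

variable {E : Type*} [NormedAddCommGroup E] [NormedSpace ℝ E]
  {M : Type*} [TopologicalSpace M] [ChartedSpace E M]
  [RiemannianBundle (fun x : M ↦ TangentSpace 𝓘(ℝ, E) x)]

/-- Half of the right-hand side of the Koszul formula: for the Levi-Civita connection `∇`
this expression is `⟨∇_X Y, Z⟩` at the point `x`. -/
def koszulForm (X Y Z : Π x : M, TangentSpace 𝓘(ℝ, E) x) (x : M) : ℝ :=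
  (1 / 2) *
    (mvfderiv 𝓘(ℝ, E) (fun y ↦ inner ℝ (Y y) (Z y)) x (X x)
      + mvfderiv 𝓘(ℝ, E) (fun y ↦ inner ℝ (X y) (Z y)) x (Y x)
      - mvfderiv 𝓘(ℝ, E) (fun y ↦ inner ℝ (X y) (Y y)) x (Z x)
      + inner ℝ (mlieBracket 𝓘(ℝ, E) X Y x) (Z x)
      - inner ℝ (mlieBracket 𝓘(ℝ, E) X Z x) (Y x)
      - inner ℝ (mlieBracket 𝓘(ℝ, E) Y Z x) (X x))

variable [IsManifold 𝓘(ℝ, E) ∞ M]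
  [IsContMDiffRiemannianBundle 𝓘(ℝ, E) ∞ E (fun x : M ↦ TangentSpace 𝓘(ℝ, E) x)]

theorem mdifferentiableAt_inner {x : M} {Y Z : Π x : M, TangentSpace 𝓘(ℝ, E) x}
    (hY : MDiffAt (T% Y) x) (hZ : MDiffAt (T% Z) x) :
    MDiffAt (fun y ↦ inner ℝ (Y y) (Z y)) x :=
  MDifferentiableAt.inner_bundle (F := E) (E := fun x : M ↦ TangentSpace 𝓘(ℝ, E) x)
    (b := id) hY hZ

variable [FiniteDimensional ℝ E]

theorem koszulForm_tensorial_left {x : M} {Y Z : Π x : M, TangentSpace 𝓘(ℝ, E) x}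
    (hY : MDiffAt (T% Y) x) (hZ : MDiffAt (T% Z) x) :
    TensorialAt 𝓘(ℝ, E) E (fun X ↦ koszulForm X Y Z x) x where
  smul {f X} hf hX := by
    have : CompleteSpace E := FiniteDimensional.complete ℝ E
    have h1 := mvfderiv_fun_mul hf (mdifferentiableAt_inner hX hZ)
    have h2 := mvfderiv_fun_mul hf (mdifferentiableAt_inner hX hY)
    simp only [koszulForm, Pi.smul_apply', mlieBracket_smul_left hf hX, inner_smul_left,
      conj_trivial, inner_add_left, inner_smul_right, h1, h2, map_smul, smul_eq_mul,
      add_apply, smul_apply]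
    ring
  add {X X'} hX hX' := by
    have : CompleteSpace E := FiniteDimensional.complete ℝ E
    have h1 := mvfderiv_fun_add (mdifferentiableAt_inner hX hZ) (mdifferentiableAt_inner hX' hZ)
    have h2 := mvfderiv_fun_add (mdifferentiableAt_inner hX hY) (mdifferentiableAt_inner hX' hY)
    simp only [koszulForm, Pi.add_apply, mlieBracket_add_left hX hX',
      inner_add_left, inner_add_right, h1, h2, map_add, add_apply]
    ring

theorem koszulForm_tensorial_right {x : M} {X Y : Π x : M, TangentSpace 𝓘(ℝ, E) x}
    (hX : MDiffAt (T% X) x) (hY : MDiffAt (T% Y) x) :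
    TensorialAt 𝓘(ℝ, E) E (fun Z ↦ koszulForm X Y Z x) x where
  smul {f Z} hf hZ := by
    have : CompleteSpace E := FiniteDimensional.complete ℝ E
    have h1 := mvfderiv_fun_mul hf (mdifferentiableAt_inner hX hZ)
    have h2 := mvfderiv_fun_mul hf (mdifferentiableAt_inner hY hZ)
    simp only [koszulForm, Pi.smul_apply', mlieBracket_smul_right hf hZ, inner_smul_left,
      conj_trivial, inner_add_left, inner_smul_right, h1, h2, map_smul, smul_eq_mul,
      add_apply, smul_apply]
    rw [real_inner_comm (Z x) (X x), real_inner_comm (Z x) (Y x)]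
    ring
  add {Z Z'} hZ hZ' := by
    have : CompleteSpace E := FiniteDimensional.complete ℝ E
    have h1 := mvfderiv_fun_add (mdifferentiableAt_inner hX hZ) (mdifferentiableAt_inner hX hZ')
    have h2 := mvfderiv_fun_add (mdifferentiableAt_inner hY hZ) (mdifferentiableAt_inner hY hZ')
    simp only [koszulForm, Pi.add_apply, mlieBracket_add_right hZ hZ',
      inner_add_left, inner_add_right, h1, h2, map_add, add_apply]
    ring

theorem koszulForm_add_mid {x : M} {X Y Y' Z : Π x : M, TangentSpace 𝓘(ℝ, E) x}
    (hX : MDiffAt (T% X) x) (hY : MDiffAt (T% Y) x) (hY' : MDiffAt (T% Y') x)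
    (hZ : MDiffAt (T% Z) x) :
    koszulForm X (Y + Y') Z x = koszulForm X Y Z x + koszulForm X Y' Z x := by
  have : CompleteSpace E := FiniteDimensional.complete ℝ E
  have h1 := mvfderiv_fun_add (mdifferentiableAt_inner hX hY) (mdifferentiableAt_inner hX hY')
  have h2 := mvfderiv_fun_add (mdifferentiableAt_inner hY hZ) (mdifferentiableAt_inner hY' hZ)
  simp only [koszulForm, Pi.add_apply, mlieBracket_add_right hY hY', mlieBracket_add_left hY hY',
    inner_add_left, inner_add_right, h1, h2, map_add, add_apply]
  ring

theorem koszulForm_smul_mid {x : M} {f : M → ℝ} {X Y Z : Π x : M, TangentSpace 𝓘(ℝ, E) x}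
    (hf : MDiffAt f x) (hX : MDiffAt (T% X) x) (hY : MDiffAt (T% Y) x)
    (hZ : MDiffAt (T% Z) x) :
    koszulForm X (f • Y) Z x =
      f x * koszulForm X Y Z x + mvfderiv 𝓘(ℝ, E) f x (X x) * inner ℝ (Y x) (Z x) := by
  have : CompleteSpace E := FiniteDimensional.complete ℝ E
  have h1 := mvfderiv_fun_mul hf (mdifferentiableAt_inner hX hY)
  have h2 := mvfderiv_fun_mul hf (mdifferentiableAt_inner hY hZ)
  simp only [koszulForm, Pi.smul_apply', mlieBracket_smul_right hf hY, mlieBracket_smul_left hf hY,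
    inner_smul_left, conj_trivial, inner_add_left, inner_smul_right, h1, h2, map_smul, smul_eq_mul,
    add_apply, smul_apply]
  rw [real_inner_comm (Y x) (X x)]
  ring

/-- The bilinear form `(u, w) ↦ ⟨∇_u Y, w⟩` on the tangent space at `x`. -/
def koszulHom (Y : Π x : M, TangentSpace 𝓘(ℝ, E) x) (x : M) (hY : MDiffAt (T% Y) x) :
    TangentSpace 𝓘(ℝ, E) x →L[ℝ] TangentSpace 𝓘(ℝ, E) x →L[ℝ] ℝ :=
  TensorialAt.mkHom₂ (fun X Z ↦ koszulForm X Y Z x) x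
    (fun _ hZ ↦ koszulForm_tensorial_left hY hZ) (fun _ hX ↦ koszulForm_tensorial_right hX hY)

open Classical in
/-- The covariant derivative `u ↦ ∇_u Y` at the point `x`, where `∇_u Y` is the tangent vector that
represents the linear functional `w ↦ ⟨∇_u Y, w⟩` given by the Koszul formula. If `Y` is not
differentiable at `x`, its value is `0`, by convention. -/
def leviCivitaFun (Y : Π x : M, TangentSpace 𝓘(ℝ, E) x) (x : M) :
    TangentSpace 𝓘(ℝ, E) x →L[ℝ] TangentSpace 𝓘(ℝ, E) x :=
  if hY : MDiffAt (T% Y) x then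
    LinearMap.toContinuousLinearMap
      { toFun := fun u ↦
          (InnerProductSpace.toDual ℝ (TangentSpace 𝓘(ℝ, E) x)).symm (koszulHom Y x hY u)
        map_add' := fun u v ↦ by simp only [map_add]
        map_smul' := fun c u ↦ by simp only [map_smul, RingHom.id_apply] }
  else 0

theorem inner_leviCivitaFun {x : M} {X Y Z : Π x : M, TangentSpace 𝓘(ℝ, E) x}
    (hX : MDiffAt (T% X) x) (hY : MDiffAt (T% Y) x) (hZ : MDiffAt (T% Z) x) :
    inner ℝ (leviCivitaFun Y x (X x)) (Z x) = koszulForm X Y Z x := by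
  rw [leviCivitaFun, dif_pos hY]
  change inner ℝ ((InnerProductSpace.toDual ℝ (TangentSpace 𝓘(ℝ, E) x)).symm
    (koszulHom Y x hY (X x))) (Z x) = _
  rw [InnerProductSpace.toDual_symm_apply]
  exact TensorialAt.mkHom₂_apply (Φ := fun X Z ↦ koszulForm X Y Z x)
    (fun _ hZ ↦ koszulForm_tensorial_left hY hZ) (fun _ hX ↦ koszulForm_tensorial_right hX hY) hX hZ

theorem isCovariantDerivativeOn_leviCivitaFun :
    IsCovariantDerivativeOn E
      (leviCivitaFun : (Π x : M, TangentSpace 𝓘(ℝ, E) x) →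
        Π x : M, TangentSpace 𝓘(ℝ, E) x →L[ℝ] TangentSpace 𝓘(ℝ, E) x) where
  add {Y Y' x} hY hY' _ := by
    ext1 u
    refine ext_inner_right ℝ fun w ↦ ?_
    have hU := FiberBundle.mdifferentiableAt_extend 𝓘(ℝ, E) E u
    have hW := FiberBundle.mdifferentiableAt_extend 𝓘(ℝ, E) E w
    have key := koszulForm_add_mid hU hY hY' hW
    rw [← inner_leviCivitaFun hU (mdifferentiableAt_add_section hY hY') hW,
      ← inner_leviCivitaFun hU hY hW, ← inner_leviCivitaFun hU hY' hW] at key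
    simpa [inner_add_left] using key
  leibniz {Y g x} hY hg _ := by
    ext1 u
    refine ext_inner_right ℝ fun w ↦ ?_
    have hU := FiberBundle.mdifferentiableAt_extend 𝓘(ℝ, E) E u
    have hW := FiberBundle.mdifferentiableAt_extend 𝓘(ℝ, E) E w
    have key := koszulForm_smul_mid hg hU hY hW
    rw [← inner_leviCivitaFun hU (hg.smul_section hY) hW,
      ← inner_leviCivitaFun hU hY hW] at key
    simpa [inner_add_left, inner_smul_left] using key

variable (E M) in
/-- The Levi-Civita connection of a Riemannian manifold. `leviCivita E M Y x u` is `∇_u Y` for a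
vector field `Y` and a tangent vector `u` at `x`. -/
def leviCivita : CovariantDerivative 𝓘(ℝ, E) E (fun x : M ↦ TangentSpace 𝓘(ℝ, E) x) :=
  ⟨leviCivitaFun, isCovariantDerivativeOn_leviCivitaFun⟩

/-- The Levi-Civita connection is torsion-free. -/
theorem leviCivita_torsion [CompleteSpace E] : (leviCivita E M).torsion = 0 := by
  rw [CovariantDerivative.torsion_eq_zero_iff]
  intro X Y x hX hY
  refine ext_inner_right ℝ fun w ↦ ?_
  have hW := FiberBundle.mdifferentiableAt_extend 𝓘(ℝ, E) E w
  have h1 := inner_leviCivitaFun hX hY hW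
  have h2 := inner_leviCivitaFun hY hX hW
  have h3 := hW
  simp only [FiberBundle.extend_apply_self] at h1 h2
  change inner ℝ (leviCivitaFun Y x (X x) - leviCivitaFun X x (Y x)) w = _
  rw [inner_sub_left, h1, h2]
  simp only [koszulForm, FiberBundle.extend_apply_self, mlieBracket_swap_apply (V := Y) (W := X),
    inner_neg_left, real_inner_comm (X _) (Y _)]
  ring

/-- The Levi-Civita connection is compatible with the metric: `u⟨Y, Z⟩ = ⟨∇_u Y, Z⟩ + ⟨Y, ∇_u Z⟩`
for every tangent vector `u`. -/
theorem leviCivita_mvfderiv_inner {x : M} {Y Z : Π x : M, TangentSpace 𝓘(ℝ, E) x}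
    (hY : MDiffAt (T% Y) x) (hZ : MDiffAt (T% Z) x) (u : TangentSpace 𝓘(ℝ, E) x) :
    mvfderiv 𝓘(ℝ, E) (fun y ↦ inner ℝ (Y y) (Z y)) x u =
      inner ℝ (leviCivita E M Y x u) (Z x) + inner ℝ (Y x) (leviCivita E M Z x u) := by
  have hU := FiberBundle.mdifferentiableAt_extend 𝓘(ℝ, E) E u
  have h1 := inner_leviCivitaFun hU hY hZ
  have h2 := inner_leviCivitaFun hU hZ hY
  simp only [FiberBundle.extend_apply_self] at h1 h2
  change _ = inner ℝ (leviCivitaFun Y x u) (Z x) + inner ℝ (Y x) (leviCivitaFun Z x u)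
  rw [real_inner_comm _ (Y x), h1, h2]
  simp only [koszulForm, FiberBundle.extend_apply_self, mlieBracket_swap_apply (V := Z) (W := Y),
    inner_neg_left, real_inner_comm (Z _) (Y _)]
  ring

end LeviCivita

section Operators

variable (E : Type*) [NormedAddCommGroup E] [NormedSpace ℝ E] [FiniteDimensional ℝ E]
  {M : Type*} [TopologicalSpace M] [ChartedSpace E M]
  [RiemannianBundle (fun x : M ↦ TangentSpace 𝓘(ℝ, E) x)]

/-- The Riemannian gradient `∇f`: the vector with `⟨∇f(x), v⟩ = df_x(v)` for all `v`. -/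
def grad (f : M → ℝ) (x : M) : TangentSpace 𝓘(ℝ, E) x :=
  (InnerProductSpace.toDual ℝ (TangentSpace 𝓘(ℝ, E) x)).symm (mvfderiv 𝓘(ℝ, E) f x)

theorem inner_grad (f : M → ℝ) (x : M) (v : TangentSpace 𝓘(ℝ, E) x) :
    inner ℝ (grad E f x) v = mvfderiv 𝓘(ℝ, E) f x v :=
  InnerProductSpace.toDual_symm_apply

/-- The function `|∇f|`. -/
def gradNorm (f : M → ℝ) (x : M) : ℝ := ‖grad E f x‖

/-- The vector field `∇f / |∇f|` (equal to `0` at the critical points of `f`). -/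
def gradNormal (f : M → ℝ) (x : M) : TangentSpace 𝓘(ℝ, E) x :=
  (gradNorm E f x)⁻¹ • grad E f x

/-- The Laplacian `Δf = div ∇f`, the trace of `v ↦ ∇_v ∇f`, that is, of the Hessian of `f`. -/
def laplacian [IsManifold 𝓘(ℝ, E) ∞ M]
    [IsContMDiffRiemannianBundle 𝓘(ℝ, E) ∞ E (fun x : M ↦ TangentSpace 𝓘(ℝ, E) x)]
    (f : M → ℝ) (x : M) : ℝ :=
  LinearMap.trace ℝ (TangentSpace 𝓘(ℝ, E) x)
    (leviCivita E M (grad E f) x : TangentSpace 𝓘(ℝ, E) x →ₗ[ℝ] TangentSpace 𝓘(ℝ, E) x)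

end Operators

section Hypersurfaces

variable (E : Type*) [NormedAddCommGroup E] [NormedSpace ℝ E]
  {M : Type*} [TopologicalSpace M] [ChartedSpace E M]

/-- `x` is a regular point of `f`: the differential of `f` at `x` does not vanish. -/
def IsRegularPoint (f : M → ℝ) (x : M) : Prop := mvfderiv 𝓘(ℝ, E) f x ≠ 0

/-- `t` is a regular value of `f`: all points of the level set `{f = t}` are regular points. -/
def IsRegularValue (f : M → ℝ) (t : ℝ) : Prop := ∀ x, f x = t → IsRegularPoint E f x

/-- `x ∈ Z`, and near `x` the set `Z` is a smooth embedded hypersurface: some smooth chart of `M`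
around `x` maps `Z` onto a piece of a linear subspace of codimension one. -/
def IsHypersurfaceAt (Z : Set M) (x : M) : Prop :=
  x ∈ Z ∧ ∃ φ ∈ IsManifold.maximalAtlas 𝓘(ℝ, E) ∞ M, x ∈ φ.source ∧
    ∃ W : Submodule ℝ E, Module.finrank ℝ W + 1 = Module.finrank ℝ E ∧
      ∀ y ∈ φ.source, y ∈ Z ↔ φ y ∈ W

/-- `Z` is a smooth embedded hypersurface of `M`. -/
def IsSmoothHypersurface (Z : Set M) : Prop := ∀ x ∈ Z, IsHypersurfaceAt E Z x

/-- The tangent space `T_x Z`, as a subspace of `T_x M`: it is spanned by the velocities `γ'(0)` of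
the smooth curves `γ : (-ε, ε) → M` with `γ(0) = x` whose image lies in `Z`. (If `Z` is a smooth
hypersurface near `x`, these velocities already form a linear subspace.) -/
def tangentSpaceOf (Z : Set M) (x : M) : Submodule ℝ (TangentSpace 𝓘(ℝ, E) x) :=
  Submodule.span ℝ {v | ∃ γ : ℝ → M, ∃ ε > 0,
    ContMDiffOn 𝓘(ℝ, ℝ) 𝓘(ℝ, E) ∞ γ (Ioo (-ε) ε) ∧ (∀ s ∈ Ioo (-ε) ε, γ s ∈ Z) ∧
    (⟨γ 0, mfderiv 𝓘(ℝ, ℝ) 𝓘(ℝ, E) γ 0 (1 : ℝ)⟩ : TangentBundle 𝓘(ℝ, E) M) = ⟨x, v⟩}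

variable {E}
variable [FiniteDimensional ℝ E] [RiemannianBundle (fun x : M ↦ TangentSpace 𝓘(ℝ, E) x)]
  [IsManifold 𝓘(ℝ, E) ∞ M]

/-- Near `x`, the vector field `N` is smooth and restricts to a unit normal field on `Z`. -/
def IsUnitNormalAt (Z : Set M) (N : Π x : M, TangentSpace 𝓘(ℝ, E) x) (x : M) : Prop :=
  ContMDiffAt 𝓘(ℝ, E) 𝓘(ℝ, E).tangent ∞ (fun y ↦ (⟨y, N y⟩ : TangentBundle 𝓘(ℝ, E) M)) x ∧
    ∀ᶠ y in 𝓝[Z] x, ‖N y‖ = 1 ∧ ∀ v ∈ tangentSpaceOf E Z y, inner ℝ (N y) v = 0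

variable [IsContMDiffRiemannianBundle 𝓘(ℝ, E) ∞ E (fun x : M ↦ TangentSpace 𝓘(ℝ, E) x)]

/-- The mean curvature `H(x) = -Tr [T_x Z ∋ u ↦ ∇_u N]` of the hypersurface `Z` at `x` with respect
to the unit normal `N`, which is given as a vector field that is smooth near `x` in `M`. For a unit
normal, `∇_u N` lies in `T_x Z`, so that the orthogonal projection to `T_x Z` does not change it. -/
def meanCurvature (Z : Set M) (N : Π x : M, TangentSpace 𝓘(ℝ, E) x) (x : M) : ℝ :=
  -LinearMap.trace ℝ (tangentSpaceOf E Z x)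
    ((tangentSpaceOf E Z x).orthogonalProjectionOnto.toLinearMap ∘ₗ
      (leviCivita E M N x).toLinearMap ∘ₗ (tangentSpaceOf E Z x).subtype)

/-- The weighted mean curvature `H_ρ = ρ H - ⟨∇ρ, N⟩` of `Z` at `x` with respect to the unit
normal `N`. -/
def weightedMeanCurvature (ρ : M → ℝ) (Z : Set M) (N : Π x : M, TangentSpace 𝓘(ℝ, E) x)
    (x : M) : ℝ :=
  ρ x * meanCurvature Z N x - inner ℝ (grad E ρ x) (N x)

/-- `Z` is a smooth hypersurface with unit normal `N`, the weight `ρ` is smooth near `Z`, and the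
weighted mean curvature of `Z` with respect to `N` is equal to `c` at all points of `Z`. -/
def HasConstantWeightedMeanCurvature (ρ : M → ℝ) (Z : Set M)
    (N : Π x : M, TangentSpace 𝓘(ℝ, E) x) (c : ℝ) : Prop :=
  IsSmoothHypersurface E Z ∧
    ∀ x ∈ Z, IsUnitNormalAt Z N x ∧ ContMDiffAt 𝓘(ℝ, E) 𝓘(ℝ, ℝ) ∞ ρ x ∧
      weightedMeanCurvature ρ Z N x = c

/-- A weighted minimal hypersurface: its weighted mean curvature vanishes. -/
def IsWeightedMinimalHypersurface (ρ : M → ℝ) (Z : Set M)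
    (N : Π x : M, TangentSpace 𝓘(ℝ, E) x) : Prop :=
  HasConstantWeightedMeanCurvature ρ Z N 0

end Hypersurfaces

end RiemannianGeometry

/-! ### Smoothness of the gradient -/

section SmoothGradient

variable {E : Type*} [NormedAddCommGroup E] [NormedSpace ℝ E]
  {M : Type*} [TopologicalSpace M] [ChartedSpace E M] [IsManifold 𝓘(ℝ, E) ∞ M]

/-! Write `∇f = ρN`. The Leibniz rule gives `∇_v ∇f = ρ ∇_v N + dρ(v) N`, and taking traces, `Δf = ρ
Tr(∇N) + ⟨∇ρ, N⟩`. Since `|N| = 1` near a regular point, `∇_v N` is orthogonal to `N`, so the normal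
direction adds nothing to the trace and `Tr(∇N) = -H`. Hence `Δf = -ρH + ⟨∇ρ, N⟩ = -H_ρ`. For an
eigenfunction, `-Δf = λf` takes the value `λt` on `Z_t`. The computation is
`IsRegularPoint.weightedMeanCurvature_eq`.

It rests on three facts. The gradient is smooth (`ContMDiff.contMDiffAt_grad`). The level set is a
hypersurface with tangent space `ker df = N^⊥`, by the inverse function theorem
(`IsRegularPoint.isHypersurfaceAt`, `IsRegularPoint.tangentSpaceOf_eq_ker`). The trace splits along
`N^⊥` and `N` (`LinearMap.trace_eq_trace_compression_add_inner`).

The choice of extension of `N` is irrelevant because a function vanishing on `Z` has zero derivative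
along `T_x Z` (`leviCivita_congr_of_mem_tangentSpaceOf`). -/

theorem ContMDiff.mvfderiv_apply {f : M → ℝ} (hf : ContMDiff 𝓘(ℝ, E) 𝓘(ℝ, ℝ) ∞ f)
    {W : Π x : M, TangentSpace 𝓘(ℝ, E) x} {x : M} (hW : CMDiffAt ∞ (T% W) x) :
    ContMDiffAt 𝓘(ℝ, E) 𝓘(ℝ, ℝ) ∞ (fun y ↦ mvfderiv 𝓘(ℝ, E) f y (W y)) x := by
  have h1 := ((hf.contMDiff_tangentMap (m := ∞) (by simp)).contMDiffAt).comp x hW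
  have h2 := (contMDiffAt_totalSpace.1 h1).2
  refine h2.congr_of_eventuallyEq (Eventually.of_forall fun y ↦ ?_)
  simp [tangentMap, mvfderiv]
  rfl

variable
  [RiemannianBundle (fun x : M ↦ TangentSpace 𝓘(ℝ, E) x)]
  [IsContMDiffRiemannianBundle 𝓘(ℝ, E) ∞ E (fun x : M ↦ TangentSpace 𝓘(ℝ, E) x)]

theorem contMDiffAt_inner {x : M} {Y Z : Π x : M, TangentSpace 𝓘(ℝ, E) x}
    (hY : CMDiffAt ∞ (T% Y) x) (hZ : CMDiffAt ∞ (T% Z) x) :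
    ContMDiffAt 𝓘(ℝ, E) 𝓘(ℝ, ℝ) ∞ (fun y ↦ inner ℝ (Y y) (Z y)) x :=
  ContMDiffAt.inner_bundle (F := E) (E := fun x : M ↦ TangentSpace 𝓘(ℝ, E) x)
    (b := id) hY hZ

variable [FiniteDimensional ℝ E]

/-- A vector field is smooth if its inner products with smooth vector fields are smooth. -/
theorem contMDiffAt_of_forall_inner {s : Π x : M, TangentSpace 𝓘(ℝ, E) x} {x : M}
    (h : ∀ W : Π x : M, TangentSpace 𝓘(ℝ, E) x, CMDiffAt ∞ (T% W) x →
      ContMDiffAt 𝓘(ℝ, E) 𝓘(ℝ, ℝ) ∞ (fun y ↦ inner ℝ (s y) (W y)) x) :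
    CMDiffAt ∞ (T% s) x := by
  classical
  let e := trivializationAt E (fun x : M ↦ TangentSpace 𝓘(ℝ, E) x) x
  have hx : x ∈ e.baseSet := FiberBundle.mem_baseSet_trivializationAt' x
  let b := Module.finBasis ℝ E
  let W := e.localFrame b
  have hW : ∀ i, CMDiffAt ∞ (T% (W i)) x := fun i ↦
    contMDiffAt_localFrame_of_mem ∞ e b i hx
  have hf := e.isLocalFrameOn_localFrame_baseSet 𝓘(ℝ, E) ∞ b
  let ι := Fin (Module.finrank ℝ E)
  let c : M → (ι → ℝ) := fun y i ↦ hf.coeff i y (s y)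
  -- The Gram operator of the frame. The coordinates `c` of `s` solve `G c = (⟨s, W j⟩)_j`, so they
  -- are smooth once `G` is smooth and invertible.
  let G : M → ((ι → ℝ) →L[ℝ] (ι → ℝ)) := fun y ↦ ∑ i, ∑ j, (inner ℝ (W i y) (W j y) : ℝ) •
    (ContinuousLinearMap.proj (R := ℝ) (φ := fun _ : ι ↦ ℝ) i).smulRight (Pi.single j (1 : ℝ))
  have hGapp : ∀ y (a : ι → ℝ) (j : ι), G y a j = inner ℝ (∑ i, a i • W i y) (W j y) := by
    intro y a j
    simp [G, sum_inner, inner_smul_left, Finset.sum_apply, Pi.single_apply, mul_comm]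
    rfl
  have hGsmooth : ContMDiffAt 𝓘(ℝ, E) 𝓘(ℝ, (ι → ℝ) →L[ℝ] (ι → ℝ)) ∞ G x := by
    refine contMDiffAt_finsetSum fun i _ ↦ contMDiffAt_finsetSum fun j _ ↦ ?_
    exact (contMDiffAt_inner (hW i) (hW j)).smul contMDiffAt_const
  have hinj : ∀ y ∈ e.baseSet, Function.Injective (G y) := by
    intro y hy
    rw [injective_iff_map_eq_zero]
    intro a ha
    -- The squared length of this vector is `∑ j, a j * G y a j`, which vanishes.
    have h0 : ∑ i, a i • W i y = 0 := by
      rw [← inner_self_eq_zero (𝕜 := ℝ)]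
      conv_lhs => rw [inner_sum]
      refine Finset.sum_eq_zero fun j _ ↦ ?_
      rw [inner_smul_right, ← hGapp, ha]
      simp
    exact funext (Fintype.linearIndependent_iff.1 (hf.linearIndependent hy) a h0)
  have hinv : ∀ y ∈ e.baseSet, (G y).IsInvertible := fun y hy ↦
    ⟨(LinearEquiv.ofInjectiveEndo (G y : (ι → ℝ) →ₗ[ℝ] (ι → ℝ)) (hinj y hy)).toContinuousLinearEquiv,
      by ext; rfl⟩
  have hc : ∀ y ∈ e.baseSet, c y = (G y).inverse (fun j ↦ inner ℝ (s y) (W j y)) := by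
    intro y hy
    have h1 : (fun j ↦ inner ℝ (s y) (W j y)) = G y (c y) := by
      funext j
      rw [hGapp, ← hf.coeff_sum_eq s hy]
    rw [h1]
    exact ((hinv y hy).inverse_apply_eq.2 rfl).symm
  have hcs : ContMDiffAt 𝓘(ℝ, E) 𝓘(ℝ, ι → ℝ) ∞ c x := by
    have h1 : ContMDiffAt 𝓘(ℝ, E) 𝓘(ℝ, ι → ℝ) ∞
        (fun y ↦ (G y).inverse (fun j ↦ inner ℝ (s y) (W j y))) x := by
      refine ContMDiffAt.clm_apply ?_ (contMDiffAt_pi_space.2 fun j ↦ h _ (hW j))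
      exact ((hinv x hx).contDiffAt_map_inverse (n := ∞)).contMDiffAt.comp x hGsmooth
    refine h1.congr_of_eventuallyEq ?_
    filter_upwards [e.open_baseSet.mem_nhds hx] with y hy using hc y hy
  exact hf.contMDiffAt_of_coeff (fun i ↦ contMDiffAt_pi_space.1 hcs i) (e.open_baseSet.mem_nhds hx)

/-- The gradient is given pointwise by Riesz duality, but its inner product with a smooth field `W`
is `df(W)`, which is smooth. -/
theorem ContMDiff.contMDiffAt_grad {f : M → ℝ} (hf : ContMDiff 𝓘(ℝ, E) 𝓘(ℝ, ℝ) ∞ f) (x : M) :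
    CMDiffAt ∞ (T% (grad E f)) x := by
  refine contMDiffAt_of_forall_inner fun W hW ↦ ?_
  simp only [inner_grad]
  exact hf.mvfderiv_apply hW

end SmoothGradient

/-! ### Level sets and their tangent spaces -/

section LevelSets

variable {E : Type*} [NormedAddCommGroup E] [NormedSpace ℝ E]
  {M : Type*} [TopologicalSpace M] [ChartedSpace E M]

/-- The differential of a function that is constant on `Z` near `x` vanishes on `T_x Z`. -/
theorem mvfderiv_eq_zero_of_mem_tangentSpaceOf {g : M → ℝ} {Z : Set M} {x : M} {c : ℝ}
    (hg : MDifferentiableAt 𝓘(ℝ, E) 𝓘(ℝ, ℝ) g x) (hc : ∀ᶠ y in 𝓝[Z] x, g y = c)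
    {v : TangentSpace 𝓘(ℝ, E) x} (hv : v ∈ tangentSpaceOf E Z x) :
    mvfderiv 𝓘(ℝ, E) g x v = 0 := by
  suffices h : tangentSpaceOf E Z x ≤ LinearMap.ker (mvfderiv 𝓘(ℝ, E) g x).toLinearMap from h hv
  refine Submodule.span_le.2 ?_
  rintro v ⟨γ, ε, hε, hγ, hZ, heq⟩
  obtain rfl : γ 0 = x := congrArg TotalSpace.proj heq
  obtain rfl : mfderiv 𝓘(ℝ, ℝ) 𝓘(ℝ, E) γ 0 (1 : ℝ) = v := by simpa using heq
  have hnhds : Ioo (-ε) ε ∈ 𝓝 (0 : ℝ) := Ioo_mem_nhds (by linarith) hε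
  have hγ0 : MDifferentiableAt 𝓘(ℝ, ℝ) 𝓘(ℝ, E) γ 0 :=
    (hγ.contMDiffAt hnhds).mdifferentiableAt (by simp)
  have hlim : Tendsto γ (𝓝 0) (𝓝[Z] (γ 0)) :=
    tendsto_nhdsWithin_iff.2 ⟨hγ0.continuousAt, mem_of_superset hnhds hZ⟩
  have h1 : (g ∘ γ) =ᶠ[𝓝 0] fun _ ↦ c := hlim.eventually hc
  have h2 : mfderiv 𝓘(ℝ, ℝ) 𝓘(ℝ, ℝ) (g ∘ γ) 0 = 0 := by
    rw [h1.mfderiv_eq, mfderiv_const]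
    rfl
  rw [mfderiv_comp 0 hg hγ0] at h2
  exact DFunLike.congr_fun h2 (1 : ℝ)

/-- Taking `u` and `v` in the model space `E` avoids transport between tangent spaces whose base
points are only propositionally equal. -/
theorem tangentBundle_mk_congr {p q : M} (hpq : p = q) {u v : E} (huv : u = v) :
    (⟨p, u⟩ : TangentBundle 𝓘(ℝ, E) M) = ⟨q, v⟩ := by
  rw [hpq, huv]

variable [FiniteDimensional ℝ E]

/-- A function with nonzero derivative at a point is, up to translation, linear in suitable
coordinates near this point. -/
theorem exists_openPartialHomeomorph_straightening {g : E → ℝ} {O : Set E} (hO : IsOpen O)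
    (hg : ContDiffOn ℝ ∞ g O) {a : E} (ha : a ∈ O) (hL : fderiv ℝ g a ≠ 0) (t : ℝ) :
    ∃ ψ : OpenPartialHomeomorph E E, a ∈ ψ.source ∧ ψ.source ⊆ O ∧
      ContDiffOn ℝ ∞ ψ ψ.source ∧ ContDiffOn ℝ ∞ ψ.symm ψ.target ∧
      ∀ z ∈ ψ.source, fderiv ℝ g a (ψ z) = g z - t := by
  have : CompleteSpace E := FiniteDimensional.complete ℝ E
  set L := fderiv ℝ g a
  obtain ⟨e, he⟩ : ∃ e, L e = 1 := by
    obtain ⟨v, hv⟩ := DFunLike.ne_iff.1 hL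
    exact ⟨(L v)⁻¹ • v, by rw [map_smul, smul_eq_mul]; exact inv_mul_cancel₀ hv⟩
  -- Replace the component `L z` of `z` along `e` by `g z - t`. As `L e = 1`, this gives `L ∘ G = g
  -- - t`; as `L` is the derivative of `g` at `a`, the derivative of `G` at `a` is the identity.
  let G : E → E := fun z ↦ z - L z • e + (g z - t) • e
  have hG : ContDiffOn ℝ ∞ G O := by
    refine (contDiffOn_id.sub (L.contDiff.contDiffOn.smul contDiffOn_const)).add ?_
    exact (hg.sub contDiffOn_const).smul contDiffOn_const
  have hGat : ∀ z ∈ O, ContDiffAt ℝ ∞ G z := fun z hz ↦ hG.contDiffAt (hO.mem_nhds hz)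
  have hGa : HasFDerivAt G ((ContinuousLinearEquiv.refl ℝ E : E ≃L[ℝ] E) : E →L[ℝ] E) a := by
    have hga : HasFDerivAt g L a :=
      ((hg.contDiffAt (hO.mem_nhds ha)).differentiableAt (by simp)).hasFDerivAt
    refine HasFDerivAt.congr_fderiv (((hasFDerivAt_id (𝕜 := ℝ) a).sub
      (L.hasFDerivAt.smul_const e)).add ((hga.sub_const t).smul_const e)) ?_
    ext v
    simp
  let ψ₀ := (hGat a ha).toOpenPartialHomeomorph G hGa (by simp)
  -- The inverse function theorem is used at `a` only. Restricting to points where the derivative of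
  -- `G` is invertible makes the inverse smooth on the whole target.
  let U := O ∩ fderiv ℝ G ⁻¹' range ((↑) : (E ≃L[ℝ] E) → E →L[ℝ] E)
  have hU : IsOpen U :=
    (hG.continuousOn_fderiv_of_isOpen hO (by simp)).isOpen_inter_preimage hO
      (ContinuousLinearEquiv.isOpen (𝕜 := ℝ) (E := E) (F := E))
  refine ⟨ψ₀.restrOpen U hU, ?_, ?_, ?_, ?_, ?_⟩
  · exact ⟨(hGat a ha).mem_toOpenPartialHomeomorph_source hGa (by simp), ha,
      ⟨_, hGa.fderiv.symm⟩⟩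
  · exact fun z hz ↦ hz.2.1
  · exact hG.mono fun z hz ↦ hz.2.1
  · intro w hw
    have h1 := (ψ₀.restrOpen U hU).map_target hw
    obtain ⟨A, hA⟩ := h1.2.2
    refine ((ψ₀.restrOpen U hU).contDiffAt_symm (f₀' := A) hw ?_ ?_).contDiffWithinAt
    · rw [hA]
      exact ((hGat _ h1.2.1).differentiableAt (by simp)).hasFDerivAt
    · exact hGat _ h1.2.1
  · intro z hz
    change L (G z) = g z - t
    simp [G, he]

/-- The tangent space of a hypersurface has codimension at most one. -/
theorem IsHypersurfaceAt.finrank_le {Z : Set M} {x : M} (h : IsHypersurfaceAt E Z x) :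
    Module.finrank ℝ E ≤ Module.finrank ℝ (tangentSpaceOf E Z x) + 1 := by
  obtain ⟨hxZ, φ, hφ, hxφ, W, hW, hZ⟩ := h
  have hsymm := contMDiffOn_symm_of_mem_maximalAtlas hφ
  have hxt : φ x ∈ φ.target := φ.map_source hxφ
  have hd : MDifferentiableAt 𝓘(ℝ, E) 𝓘(ℝ, E) φ.symm (φ x) :=
    (hsymm.contMDiffAt (φ.open_target.mem_nhds hxt)).mdifferentiableAt (by simp)
  have hd' : MDifferentiableAt 𝓘(ℝ, E) 𝓘(ℝ, E) φ (φ.symm (φ x)) :=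
    (contMDiffAt_of_mem_maximalAtlas hφ (φ.map_target hxt)).mdifferentiableAt (by simp)
  have hxx : φ.symm (φ x) = x := φ.left_inv hxφ
  let D : E →ₗ[ℝ] E := (mfderiv 𝓘(ℝ, E) 𝓘(ℝ, E) φ.symm (φ x)).toLinearMap
  have hD : Function.Injective D := by
    have h1 : φ ∘ φ.symm =ᶠ[𝓝 (φ x)] id :=
      mem_of_superset (φ.open_target.mem_nhds hxt) fun z hz ↦ φ.right_inv hz
    have h2 := h1.mfderiv_eq (I := 𝓘(ℝ, E)) (I' := 𝓘(ℝ, E))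
    rw [mfderiv_comp _ hd' hd, mfderiv_id] at h2
    exact Function.LeftInverse.injective (g := mfderiv 𝓘(ℝ, E) 𝓘(ℝ, E) φ (φ.symm (φ x)))
      fun v ↦ DFunLike.congr_fun h2 v
  let T : Submodule ℝ E := tangentSpaceOf E Z x
  -- For `w ∈ W`, the chart pulls the segment `φ x + s • w` back to a curve in `Z` with velocity `D
  -- w`. Injectivity of `D` then bounds the dimension of `T` from below.
  have hle : W.map D ≤ T := by
    rintro _ ⟨w, hw, rfl⟩
    refine Submodule.subset_span (R := ℝ) (M := TangentSpace 𝓘(ℝ, E) x) ?_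
    let l : ℝ → E := fun s ↦ φ x + s • w
    have hl : ContDiff ℝ ∞ l := contDiff_const.add (contDiff_id.smul contDiff_const)
    have hl0 : l 0 = φ x := by simp [l]
    obtain ⟨ε, hε, hball⟩ := Metric.mem_nhds_iff.1
      (hl.continuous.continuousAt.preimage_mem_nhds (φ.open_target.mem_nhds (hl0 ▸ hxt)))
    rw [Real.ball_eq_Ioo, zero_sub, zero_add] at hball
    refine ⟨φ.symm ∘ l, ε, hε, hsymm.comp hl.contMDiff.contMDiffOn hball, fun s hs ↦ ?_, ?_⟩
    · refine (hZ _ (φ.map_target (hball hs))).2 ?_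
      rw [φ.right_inv (hball hs)]
      exact W.add_mem ((hZ x hxφ).1 hxZ) (W.smul_mem s hw)
    · have hld : MDifferentiableAt 𝓘(ℝ, ℝ) 𝓘(ℝ, E) l 0 :=
        (hl.contMDiff.contMDiffAt).mdifferentiableAt (by simp)
      have h1 : mfderiv 𝓘(ℝ, ℝ) 𝓘(ℝ, E) (φ.symm ∘ l) 0 (1 : ℝ) = D w := by
        rw [mfderiv_comp_of_eq hd hld hl0]
        have h2 : mfderiv 𝓘(ℝ, ℝ) 𝓘(ℝ, E) l 0 (1 : ℝ) = w := by
          have h3 : HasDerivAt l w 0 := by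
            have h4 := ((hasDerivAt_id (0 : ℝ)).smul_const w).const_add (φ x)
            rw [one_smul] at h4
            exact h4
          rw [mfderiv_eq_fderiv]
          exact h3.deriv
        have h3 : mfderiv 𝓘(ℝ, E) 𝓘(ℝ, E) φ.symm (l 0) w = D w := by
          rw [hl0]
          rfl
        exact (congrArg (mfderiv 𝓘(ℝ, E) 𝓘(ℝ, E) φ.symm (l 0)) h2).trans h3
      exact tangentBundle_mk_congr (by simp [hl0, hxx]) h1
  have h3 := Submodule.finrank_mono hle
  rw [← (Submodule.equivMapOfInjective D hD W).finrank_eq] at h3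
  change _ ≤ Module.finrank ℝ T + 1
  omega

variable [IsManifold 𝓘(ℝ, E) ∞ M]

/-- Composing the chart at `x` with a straightening of `f` turns `f - f x` into the nonzero
functional `df_x`, so the level set becomes its kernel. -/
theorem IsRegularPoint.isHypersurfaceAt {f : M → ℝ} (hf : ContMDiff 𝓘(ℝ, E) 𝓘(ℝ, ℝ) ∞ f) {x : M}
    (hx : IsRegularPoint E f x) : IsHypersurfaceAt E {y | f y = f x} x := by
  refine ⟨rfl, ?_⟩
  let φ := chartAt E x
  have hφ : φ ∈ IsManifold.maximalAtlas 𝓘(ℝ, E) ∞ M := IsManifold.chart_mem_maximalAtlas x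
  have hg : ContDiffOn ℝ ∞ (f ∘ φ.symm) φ.target :=
    contMDiffOn_iff_contDiffOn.1 (hf.comp_contMDiffOn (contMDiffOn_symm_of_mem_maximalAtlas hφ))
  have hL : fderiv ℝ (f ∘ φ.symm) (φ x) = mvfderiv 𝓘(ℝ, E) f x := by
    rw [((hf x).mdifferentiableAt (by simp)).mvfderiv]
    simp [writtenInExtChartAt, φ]
    rfl
  have hL0 : fderiv ℝ (f ∘ φ.symm) (φ x) ≠ 0 := hL ▸ hx
  obtain ⟨ψ, hψx, hψO, hψ, hψ', hψg⟩ := exists_openPartialHomeomorph_straightening φ.open_target hg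
    (mem_chart_target E x) hL0 (f x)
  refine ⟨φ ≫ₕ ψ, ?_, ⟨mem_chart_source E x, hψx⟩,
    LinearMap.ker (fderiv ℝ (f ∘ φ.symm) (φ x)).toLinearMap, ?_, ?_⟩
  · apply OpenPartialHomeomorph.mem_maximalAtlas_of_contMDiffOn
    · exact hψ.contMDiffOn.comp
        ((contMDiffOn_of_mem_maximalAtlas hφ).mono fun y hy ↦ hy.1) fun y hy ↦ hy.2
    · exact (contMDiffOn_symm_of_mem_maximalAtlas hφ).comp
        (hψ'.contMDiffOn.mono fun y hy ↦ hy.1) fun y hy ↦ hy.2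
  · refine Module.Dual.finrank_ker_add_one_of_ne_zero
      (f := (fderiv ℝ (f ∘ φ.symm) (φ x)).toLinearMap) ?_
    exact fun h ↦ hL0 (ContinuousLinearMap.coe_injective h)
  · intro y hy
    have := hψg (φ y) hy.2
    simp only [Function.comp, φ.left_inv hy.1] at this
    change f y = f x ↔ fderiv ℝ (f ∘ φ.symm) (φ x) (ψ (φ y)) = 0
    rw [show fderiv ℝ (f ∘ φ.symm) (φ x) (ψ (φ y)) = f y - f x from this, sub_eq_zero]

/-- One inclusion holds because `f` is constant on its level set; equality follows by comparing
dimensions, since the kernel has codimension one and the tangent space at most one. -/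
theorem IsRegularPoint.tangentSpaceOf_eq_ker {f : M → ℝ} (hf : ContMDiff 𝓘(ℝ, E) 𝓘(ℝ, ℝ) ∞ f)
    {x : M} (hx : IsRegularPoint E f x) :
    tangentSpaceOf E {y | f y = f x} x = LinearMap.ker (mvfderiv 𝓘(ℝ, E) f x).toLinearMap := by
  refine Submodule.eq_of_le_of_finrank_le (fun v hv ↦ ?_) ?_
  · exact mvfderiv_eq_zero_of_mem_tangentSpaceOf ((hf x).mdifferentiableAt (by simp))
      (eventually_mem_nhdsWithin) hv
  · have h1 := (hx.isHypersurfaceAt hf).finrank_le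
    have h2 : Module.finrank ℝ (LinearMap.ker (mvfderiv 𝓘(ℝ, E) f x).toLinearMap) + 1 =
        Module.finrank ℝ E :=
      Module.Dual.finrank_ker_add_one_of_ne_zero (f := (mvfderiv 𝓘(ℝ, E) f x).toLinearMap)
        fun h ↦ hx (ContinuousLinearMap.coe_injective h)
    omega

end LevelSets

/-! ### Trace and compression to a hyperplane -/

/-- The trace of an endomorphism of an inner product space, in terms of its compression to the
orthogonal complement `K` of a unit vector `n`. -/
theorem LinearMap.trace_eq_trace_compression_add_inner {V : Type*} [NormedAddCommGroup V]
    [InnerProductSpace ℝ V] [FiniteDimensional ℝ V] (A : V →ₗ[ℝ] V) (K : Submodule ℝ V) {n : V}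
    (hn : ‖n‖ = 1) (hK : ∀ v, v ∈ K ↔ inner ℝ n v = 0) :
    LinearMap.trace ℝ V A =
      LinearMap.trace ℝ K (K.orthogonalProjectionOnto.toLinearMap ∘ₗ A ∘ₗ K.subtype) +
        inner ℝ n (A n) := by
  have hproj : ∀ v, K.starProjection v = v - (inner ℝ n v : ℝ) • n := by
    intro v
    refine Submodule.eq_starProjection_of_mem_of_inner_eq_zero ?_ fun w hw ↦ ?_
    · rw [hK, inner_sub_right, inner_smul_right, real_inner_self_eq_norm_sq, hn]
      ring
    · rw [sub_sub_cancel, inner_smul_left, (hK w).1 hw, mul_zero]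
  -- Split `v` into its projection to `K` and `⟨n, v⟩ n`. By cyclicity the first term has the trace
  -- of the compression; the rank-one term has trace `⟨n, A n⟩`.
  have hA : A = (A ∘ₗ K.subtype) ∘ₗ K.orthogonalProjectionOnto.toLinearMap +
      (innerₛₗ ℝ n).smulRight (A n) := by
    ext v
    simp [hproj]
  conv_lhs => rw [hA, map_add, LinearMap.trace_smulRight, LinearMap.trace_comp_comm']
  rfl

/-! ### The unit normal field of the level sets -/

section Gradient

variable {E : Type*} [NormedAddCommGroup E] [NormedSpace ℝ E] [FiniteDimensional ℝ E]
  {M : Type*} [TopologicalSpace M] [ChartedSpace E M]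
  [RiemannianBundle (fun x : M ↦ TangentSpace 𝓘(ℝ, E) x)]

theorem isRegularPoint_iff_grad_ne_zero {f : M → ℝ} {x : M} :
    IsRegularPoint E f x ↔ grad E f x ≠ 0 := by
  rw [IsRegularPoint, grad, ne_eq, ne_eq, EmbeddingLike.map_eq_zero_iff]

theorem IsRegularPoint.gradNorm_ne_zero {f : M → ℝ} {x : M} (hx : IsRegularPoint E f x) :
    gradNorm E f x ≠ 0 :=
  norm_ne_zero_iff.2 (isRegularPoint_iff_grad_ne_zero.1 hx)

theorem IsRegularPoint.norm_gradNormal {f : M → ℝ} {x : M} (hx : IsRegularPoint E f x) :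
    ‖gradNormal E f x‖ = 1 := by
  rw [gradNormal, norm_smul, norm_inv, gradNorm, norm_norm]
  exact inv_mul_cancel₀ hx.gradNorm_ne_zero

/-- At critical points both sides are zero, so the identity holds between global fields and can be
rewritten inside the connection. -/
theorem gradNorm_smul_gradNormal (f : M → ℝ) : gradNorm E f • gradNormal E f = grad E f := by
  funext x
  rw [Pi.smul_apply', gradNormal]
  by_cases h : grad E f x = 0
  · simp [h]
  · exact smul_inv_smul₀ (norm_ne_zero_iff.2 h) _

theorem inner_gradNormal (f : M → ℝ) (x : M) (v : TangentSpace 𝓘(ℝ, E) x) :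
    inner ℝ (gradNormal E f x) v = (gradNorm E f x)⁻¹ * mvfderiv 𝓘(ℝ, E) f x v := by
  rw [gradNormal, real_inner_smul_left, inner_grad]

variable [IsManifold 𝓘(ℝ, E) ∞ M]

theorem IsRegularPoint.mem_tangentSpaceOf_iff {f : M → ℝ}
    (hf : ContMDiff 𝓘(ℝ, E) 𝓘(ℝ, ℝ) ∞ f) {x : M} (hx : IsRegularPoint E f x)
    (v : TangentSpace 𝓘(ℝ, E) x) :
    v ∈ tangentSpaceOf E {y | f y = f x} x ↔ inner ℝ (gradNormal E f x) v = 0 := by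
  rw [hx.tangentSpaceOf_eq_ker hf, inner_gradNormal, mul_eq_zero,
    or_iff_right (inv_ne_zero hx.gradNorm_ne_zero)]
  rfl

variable
  [IsContMDiffRiemannianBundle 𝓘(ℝ, E) ∞ E (fun x : M ↦ TangentSpace 𝓘(ℝ, E) x)]

theorem IsRegularPoint.eventually {f : M → ℝ}
    (hf : ContMDiff 𝓘(ℝ, E) 𝓘(ℝ, ℝ) ∞ f) {x : M} (hx : IsRegularPoint E f x) :
    ∀ᶠ y in 𝓝 x, IsRegularPoint E f y := by
  have h := (contMDiffAt_inner (hf.contMDiffAt_grad x) (hf.contMDiffAt_grad x)).continuousAt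
  have h0 : inner ℝ (grad E f x) (grad E f x) ≠ 0 :=
    inner_self_ne_zero.2 (isRegularPoint_iff_grad_ne_zero.1 hx)
  filter_upwards [h.eventually_ne h0] with y hy
  exact isRegularPoint_iff_grad_ne_zero.2 (inner_self_ne_zero.1 hy)

theorem IsRegularPoint.contMDiffAt_gradNorm {f : M → ℝ}
    (hf : ContMDiff 𝓘(ℝ, E) 𝓘(ℝ, ℝ) ∞ f) {x : M} (hx : IsRegularPoint E f x) :
    ContMDiffAt 𝓘(ℝ, E) 𝓘(ℝ, ℝ) ∞ (gradNorm E f) x := by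
  have h0 : inner ℝ (grad E f x) (grad E f x) ≠ 0 :=
    inner_self_ne_zero.2 (isRegularPoint_iff_grad_ne_zero.1 hx)
  have h : gradNorm E f = Real.sqrt ∘ fun y ↦ inner ℝ (grad E f y) (grad E f y) :=
    funext fun y ↦ norm_eq_sqrt_real_inner _
  rw [h]
  exact (Real.contDiffAt_sqrt h0).contMDiffAt.comp x
    (contMDiffAt_inner (hf.contMDiffAt_grad x) (hf.contMDiffAt_grad x))

theorem IsRegularPoint.contMDiffAt_gradNormal {f : M → ℝ}
    (hf : ContMDiff 𝓘(ℝ, E) 𝓘(ℝ, ℝ) ∞ f) {x : M} (hx : IsRegularPoint E f x) :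
    CMDiffAt ∞ (T% (gradNormal E f)) x :=
  ((contDiffAt_inv ℝ hx.gradNorm_ne_zero).contMDiffAt.comp x
    (hx.contMDiffAt_gradNorm hf)).smul_section (hf.contMDiffAt_grad x)

theorem IsRegularPoint.isUnitNormalAt_gradNormal {f : M → ℝ}
    (hf : ContMDiff 𝓘(ℝ, E) 𝓘(ℝ, ℝ) ∞ f) {x : M} (hx : IsRegularPoint E f x) :
    IsUnitNormalAt {y | f y = f x} (gradNormal E f) x := by
  refine ⟨hx.contMDiffAt_gradNormal hf, ?_⟩
  filter_upwards [nhdsWithin_le_nhds (hx.eventually hf)] with y hy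
  refine ⟨hy.norm_gradNormal, fun v hv ↦ ?_⟩
  rw [inner_gradNormal, mvfderiv_eq_zero_of_mem_tangentSpaceOf
    ((hf y).mdifferentiableAt (by simp)) eventually_mem_nhdsWithin hv, mul_zero]

end Gradient

/-! ### Covariant derivatives of the normal and curvature -/

section Curvature

variable {E : Type*} [NormedAddCommGroup E] [NormedSpace ℝ E] [FiniteDimensional ℝ E]
  {M : Type*} [TopologicalSpace M] [ChartedSpace E M]
  [RiemannianBundle (fun x : M ↦ TangentSpace 𝓘(ℝ, E) x)]
  [IsManifold 𝓘(ℝ, E) ∞ M]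
  [IsContMDiffRiemannianBundle 𝓘(ℝ, E) ∞ E (fun x : M ↦ TangentSpace 𝓘(ℝ, E) x)]

/-- The covariant derivatives of a vector field of constant length are orthogonal to it. -/
theorem inner_leviCivita_self_eq_zero {N : Π x : M, TangentSpace 𝓘(ℝ, E) x} {x : M} {c : ℝ}
    (hN : MDiffAt (T% N) x) (hc : ∀ᶠ y in 𝓝 x, ‖N y‖ = c) (u : TangentSpace 𝓘(ℝ, E) x) :
    inner ℝ (N x) (leviCivita E M N x u) = 0 := by
  have h1 := leviCivita_mvfderiv_inner hN hN u
  have h2 : (fun y ↦ (inner ℝ (N y) (N y) : ℝ)) =ᶠ[𝓝 x] fun _ ↦ c ^ 2 := by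
    filter_upwards [hc] with y hy
    rw [real_inner_self_eq_norm_sq, hy]
  have h3 : mvfderiv 𝓘(ℝ, E) (fun y ↦ (inner ℝ (N y) (N y) : ℝ)) x u = 0 := by
    rw [mvfderiv, ((hasMFDerivAt_const (c ^ 2) x).congr_of_eventuallyEq h2).mfderiv]
    rfl
  rw [h3, real_inner_comm (N x)] at h1
  linarith

/-- Along `Z`, the tangential covariant derivatives of a vector field only depend on its values
on `Z`. -/
theorem leviCivita_congr_of_mem_tangentSpaceOf {N N' : Π x : M, TangentSpace 𝓘(ℝ, E) x} {x : M}
    {Z : Set M} (hx : x ∈ Z) (hN : MDiffAt (T% N) x) (hN' : MDiffAt (T% N') x)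
    (h : ∀ᶠ y in 𝓝[Z] x, N y = N' y) {u : TangentSpace 𝓘(ℝ, E) x}
    (hu : u ∈ tangentSpaceOf E Z x) :
    leviCivita E M N x u = leviCivita E M N' x u := by
  refine ext_inner_right ℝ fun w ↦ ?_
  have hW := FiberBundle.mdifferentiableAt_extend 𝓘(ℝ, E) E w
  have h1 := leviCivita_mvfderiv_inner hN hW u
  have h2 := leviCivita_mvfderiv_inner hN' hW u
  -- With `W` the extension of `w`, the function `⟨N, W⟩ - ⟨N', W⟩` vanishes on `Z` near `x`.
  -- Expanding its derivative by metric compatibility, the terms with `∇_u W` cancel because `N x =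
  -- N' x`.
  have h3 := mvfderiv_eq_zero_of_mem_tangentSpaceOf (c := 0)
    ((mdifferentiableAt_inner hN hW).sub (mdifferentiableAt_inner hN' hW)) ?_ hu
  · rw [mvfderiv_sub (mdifferentiableAt_inner hN hW) (mdifferentiableAt_inner hN' hW),
      sub_apply, h1, h2, h.self_of_nhdsWithin hx] at h3
    simp only [FiberBundle.extend_apply_self] at h3
    linarith
  · filter_upwards [h] with y hy
    simp [hy]

/-- The trace in `meanCurvature` only involves `∇_u N` with `u` tangent to `Z`, and the weight term
only the value `N x`. -/
theorem weightedMeanCurvature_congr {N N' : Π x : M, TangentSpace 𝓘(ℝ, E) x} {x : M}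
    {Z : Set M} (ρ : M → ℝ) (hx : x ∈ Z) (hN : MDiffAt (T% N) x) (hN' : MDiffAt (T% N') x)
    (h : ∀ᶠ y in 𝓝[Z] x, N y = N' y) :
    weightedMeanCurvature ρ Z N x = weightedMeanCurvature ρ Z N' x := by
  have h1 : (leviCivita E M N x).toLinearMap ∘ₗ (tangentSpaceOf E Z x).subtype =
      (leviCivita E M N' x).toLinearMap ∘ₗ (tangentSpaceOf E Z x).subtype :=
    LinearMap.ext fun u ↦ leviCivita_congr_of_mem_tangentSpaceOf hx hN hN' h u.2
  rw [weightedMeanCurvature, weightedMeanCurvature, meanCurvature, meanCurvature, h1,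
    h.self_of_nhdsWithin hx]

theorem IsRegularPoint.weightedMeanCurvature_eq {f : M → ℝ}
    (hf : ContMDiff 𝓘(ℝ, E) 𝓘(ℝ, ℝ) ∞ f) {x : M} (hx : IsRegularPoint E f x) :
    weightedMeanCurvature (gradNorm E f) {y | f y = f x} (gradNormal E f) x
      = -laplacian E f x := by
  have hN : MDiffAt (T% (gradNormal E f)) x :=
    (hx.contMDiffAt_gradNormal hf).mdifferentiableAt (by simp)
  have hρ : MDiffAt (gradNorm E f) x := (hx.contMDiffAt_gradNorm hf).mdifferentiableAt (by simp)
  have hNN : inner ℝ (gradNormal E f x) (leviCivita E M (gradNormal E f) x (gradNormal E f x)) = 0 :=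
    inner_leviCivita_self_eq_zero hN ((hx.eventually hf).mono fun y hy ↦ hy.norm_gradNormal) _
  have htr := LinearMap.trace_eq_trace_compression_add_inner
    (leviCivita E M (gradNormal E f) x).toLinearMap (tangentSpaceOf E {y | f y = f x} x)
    hx.norm_gradNormal (hx.mem_tangentSpaceOf_iff hf)
  -- Trace of the Leibniz rule for `∇f = ρN`; the rank-one term `v ↦ dρ(v) N` contributes `dρ(N)`.
  have hlap : laplacian E f x = gradNorm E f x *
      LinearMap.trace ℝ (TangentSpace 𝓘(ℝ, E) x) (leviCivita E M (gradNormal E f) x).toLinearMap +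
      mvfderiv 𝓘(ℝ, E) (gradNorm E f) x (gradNormal E f x) := by
    have h := (leviCivita E M).isCovariantDerivativeOn.leibniz hN hρ (mem_univ x)
    rw [gradNorm_smul_gradNormal] at h
    have h' : (leviCivita E M (grad E f) x).toLinearMap =
        gradNorm E f x • (leviCivita E M (gradNormal E f) x).toLinearMap +
          (mvfderiv 𝓘(ℝ, E) (gradNorm E f) x).toLinearMap.smulRight (gradNormal E f x) := by
      rw [h]
      rfl
    rw [laplacian, h', map_add, map_smul, LinearMap.trace_smulRight]
    rfl
  rw [weightedMeanCurvature, meanCurvature, inner_grad, hlap, htr]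
  simp only [ContinuousLinearMap.coe_coe, hNN]
  ring

end Curvature

/-! ### The main theorem -/

theorem proposition2p3
    {E : Type*} [NormedAddCommGroup E] [NormedSpace ℝ E] [FiniteDimensional ℝ E]
    {M : Type*} [TopologicalSpace M] [T2Space M] [ChartedSpace E M] [IsManifold 𝓘(ℝ, E) ∞ M]
    [RiemannianBundle (fun x : M ↦ TangentSpace 𝓘(ℝ, E) x)]
    [IsContMDiffRiemannianBundle 𝓘(ℝ, E) ∞ E (fun x : M ↦ TangentSpace 𝓘(ℝ, E) x)]
    (f : M → ℝ) (hf : ContMDiff 𝓘(ℝ, E) 𝓘(ℝ, ℝ) ∞ f) :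
    -- the level set through a regular point
    (∀ x : M, IsRegularPoint E f x →
      IsHypersurfaceAt E {y | f y = f x} x ∧
      IsUnitNormalAt {y | f y = f x} (gradNormal E f) x ∧
      ContMDiffAt 𝓘(ℝ, E) 𝓘(ℝ, ℝ) ∞ (gradNorm E f) x ∧
      weightedMeanCurvature (gradNorm E f) {y | f y = f x} (gradNormal E f) x
        = -laplacian E f x ∧
      -- the value only depends on the normal along the level set
      ∀ N : Π y : M, TangentSpace 𝓘(ℝ, E) y,
        ContMDiffAt 𝓘(ℝ, E) 𝓘(ℝ, E).tangent ∞
          (fun y ↦ (⟨y, N y⟩ : TangentBundle 𝓘(ℝ, E) M)) x →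
        (∀ᶠ y in 𝓝[{y | f y = f x}] x, N y = gradNormal E f y) →
        weightedMeanCurvature (gradNorm E f) {y | f y = f x} N x = -laplacian E f x) ∧
    -- eigenfunctions of the Laplacian
    (∀ μ : ℝ, (∀ x : M, laplacian E f x = -μ * f x) →
      (∀ t : ℝ, IsRegularValue E f t →
        HasConstantWeightedMeanCurvature (gradNorm E f) {x | f x = t} (gradNormal E f) (μ * t)) ∧
      (IsRegularValue E f 0 →
        IsWeightedMinimalHypersurface (gradNorm E f) {x | f x = 0} (gradNormal E f))) := by
  have hlevel : ∀ x : M, IsRegularPoint E f x → ∀ N : Π y : M, TangentSpace 𝓘(ℝ, E) y,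
      CMDiffAt ∞ (T% N) x → (∀ᶠ y in 𝓝[{y | f y = f x}] x, N y = gradNormal E f y) →
      weightedMeanCurvature (gradNorm E f) {y | f y = f x} N x = -laplacian E f x := by
    intro x hx N hN h
    rw [weightedMeanCurvature_congr (gradNorm E f) (rfl : x ∈ {y | f y = f x})
      (hN.mdifferentiableAt (by simp))
      ((hx.contMDiffAt_gradNormal hf).mdifferentiableAt (by simp)) h]
    exact hx.weightedMeanCurvature_eq hf
  have hconst : ∀ μ : ℝ, (∀ x : M, laplacian E f x = -μ * f x) → ∀ t : ℝ, IsRegularValue E f t →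
      HasConstantWeightedMeanCurvature (gradNorm E f) {x | f x = t} (gradNormal E f) (μ * t) := by
    refine fun μ hμ t ht ↦ ⟨?_, ?_⟩
    · rintro x rfl
      exact (ht x rfl).isHypersurfaceAt hf
    · rintro x rfl
      refine ⟨(ht x rfl).isUnitNormalAt_gradNormal hf, (ht x rfl).contMDiffAt_gradNorm hf, ?_⟩
      rw [(ht x rfl).weightedMeanCurvature_eq hf, hμ]
      ring
  refine ⟨fun x hx ↦ ⟨hx.isHypersurfaceAt hf, hx.isUnitNormalAt_gradNormal hf,
    hx.contMDiffAt_gradNorm hf, hx.weightedMeanCurvature_eq hf, hlevel x hx⟩,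
    fun μ hμ ↦ ⟨hconst μ hμ, fun h0 ↦ ?_⟩⟩
  have := hconst μ hμ 0 h0
  rwa [mul_zero] at this
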